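/- Let $\mathrm{M}_n$ be the algebra of complex $n\times n$ matrices with $\langle A,B\rangle=\operatorname{tr}(A^*B)$. For a real linear subspace $\mathcal{R}\subset\mathrm{M}_n$ that contains the identity $\mathbb{1}_n$ and is closed under $A\mapsto A^*$, let $\mathcal{C}(\mathcal{R})$ be the set of positive semidefinite matrices in $\mathcal{R}$, and let $$\mathcal{D}(\mathcal{R})=\{\rho\in\mathcal{R} : \rho^*=\rho,\ \operatorname{tr}\rho=1,\ \langle\rho,B\rangle\ge 0\ \text{for all } B\in\mathcal{C}(\mathcal{R})\}$$ be its set of density matrices. Let $\mathcal{A}$ be a real $*$-subalgebra of $\mathrm{M}_n$, that is, a real linear subspace that contains $\mathbb{1}_n$ and is closed under matrix multiplication and conjugate transposition. Let $\pi:\mathrm{M}_n\to\mathcal{A}$ be the orthogonal projection with respect to the Euclidean scalar product $\operatorname{Re}\langle A,B\rangle$. Then: 1. $\pi$ maps $\mathcal{D}(\mathrm{M}_n)$ into $\mathcal{D}(\mathcal{A})$, $\mathcal{D}(\mathcal{A})\subset\mathcal{D}(\mathrm{M}_n)$, and the restricted map $\pi:\mathcal{D}(\mathrm{M}_n)\to\mathcal{D}(\mathcal{A})$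 is a retraction with the inclusion $\mathcal{D}(\mathcal{A})\to\mathcal{D}(\mathrm{M}_n)$ as a section. Here a *retraction* is an affine map $f:K\to L$ between compact convex sets for which there is an affine map $g:L\to K$, called a *section*, with $f\circ g=\mathrm{id}_L$. 2. $\mathcal{D}(\mathcal{A})$ is a stable convex set: the midpoint map $\mathcal{D}(\mathcal{A})\times\mathcal{D}(\mathcal{A})\to\mathcal{D}(\mathcal{A})$, $(x,y)\mapsto\frac12(x+y)$, is open in the relative topologies. -/

import Mathlib

open scoped Matrix ComplexOrder

namespace MatrixSystem

/-- The Frobenius inner product `⟨A, B⟩ = tr (A* B)` of two complex `n × n` matrices. -/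
def frobenius {n : ℕ} (A B : Matrix (Fin n) (Fin n) ℂ) : ℂ :=
  (Aᴴ * B).trace

/-- The Euclidean scalar product `Re ⟨A, B⟩` on `M_n`, as a real bilinear form. -/
noncomputable def euclidean (n : ℕ) : LinearMap.BilinForm ℝ (Matrix (Fin n) (Fin n) ℂ) :=
  LinearMap.mk₂ ℝ (fun A B => (frobenius A B).re)
    (fun A A' B => by simp [frobenius, Matrix.add_mul])
    (fun c A B => by simp [frobenius])
    (fun A B B' => by simp [frobenius, Matrix.mul_add])
    (fun c A B => by simp [frobenius])

theorem euclidean_apply {n : ℕ} (A B : Matrix (Fin n) (Fin n) ℂ) :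
    euclidean n A B = (frobenius A B).re := rfl

theorem frobenius_star_swap {n : ℕ} (A B : Matrix (Fin n) (Fin n) ℂ) :
    star (frobenius A B) = frobenius B A := by
  simp only [frobenius]
  rw [← Matrix.trace_conjTranspose, Matrix.conjTranspose_mul, Matrix.conjTranspose_conjTranspose]

theorem euclidean_isSymm (n : ℕ) : (euclidean n).IsSymm :=
  ⟨fun A B => by
    simp only [euclidean_apply]
    rw [← frobenius_star_swap A B]
    simp⟩

theorem euclidean_self_eq_zero {n : ℕ} {A : Matrix (Fin n) (Fin n) ℂ}
    (h : euclidean n A A = 0) : A = 0 := by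
  have h0 : 0 ≤ (Aᴴ * A).trace := (Matrix.posSemidef_conjTranspose_mul_self A).trace_nonneg
  have h1 : (Aᴴ * A).trace = 0 := by
    apply Complex.ext
    · exact h
    · exact (Complex.le_def.mp h0).2.symm
  exact Matrix.trace_conjTranspose_mul_self_eq_zero_iff.mp h1

/-- A real subspace of `M_n` and its orthogonal complement for `Re ⟨·, ·⟩` are complementary. -/
theorem isCompl_orthogonal {n : ℕ} (R : Submodule ℝ (Matrix (Fin n) (Fin n) ℂ)) :
    IsCompl R ((euclidean n).orthogonal R) := by
  rw [LinearMap.BilinForm.isCompl_orthogonal_iff_disjoint (euclidean_isSymm n).isRefl,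
    Submodule.disjoint_def]
  intro A hA hA'
  exact euclidean_self_eq_zero (hA' A hA)

/-- The orthogonal projection `M_n → R` onto a real subspace `R` with respect to `Re ⟨·, ·⟩`. -/
noncomputable def orthProj {n : ℕ} (R : Submodule ℝ (Matrix (Fin n) (Fin n) ℂ)) :
    Matrix (Fin n) (Fin n) ℂ →ₗ[ℝ] R :=
  R.projectionOnto ((euclidean n).orthogonal R) (isCompl_orthogonal R)

/-- `π(A) ∈ R` is characterized by `Re ⟨A - π(A), B⟩ = 0` for all `B ∈ R`. -/
theorem orthProj_eq_iff {n : ℕ} (R : Submodule ℝ (Matrix (Fin n) (Fin n) ℂ))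
    (A : Matrix (Fin n) (Fin n) ℂ) (P : R) :
    orthProj R A = P ↔ ∀ B ∈ R, (frobenius (A - (P : Matrix (Fin n) (Fin n) ℂ)) B).re = 0 := by
  have key : orthProj R A = P ↔
      A - (P : Matrix (Fin n) (Fin n) ℂ) ∈ (euclidean n).orthogonal R := by
    have h1 : orthProj R (A - (P : Matrix (Fin n) (Fin n) ℂ)) = orthProj R A - P := by
      rw [map_sub]
      congr 1
      exact Submodule.projectionOnto_apply_left (isCompl_orthogonal R) P
    rw [← sub_eq_zero, ← h1]
    exact Submodule.projectionOnto_apply_eq_zero_iff (isCompl_orthogonal R)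
  rw [key]
  refine forall₂_congr fun B _ => ?_
  change euclidean n B _ = 0 ↔ euclidean n _ B = 0
  rw [(euclidean_isSymm n).eq_iff]

/-- The positive cone `C(R)`: the positive semidefinite matrices in `R`. -/
def posCone {n : ℕ} (R : Submodule ℝ (Matrix (Fin n) (Fin n) ℂ)) :
    Set (Matrix (Fin n) (Fin n) ℂ) :=
  {A | A ∈ R ∧ A.PosSemidef}

/-- The hermitian matrices `H(R)` in `R`. -/
def hermitianPart {n : ℕ} (R : Submodule ℝ (Matrix (Fin n) (Fin n) ℂ)) :
    Set (Matrix (Fin n) (Fin n) ℂ) :=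
  {A | A ∈ R ∧ A.IsHermitian}

/-- The dual cone `C(R)^∨` of the positive cone, taken inside `H(R)`. -/
def dualCone {n : ℕ} (R : Submodule ℝ (Matrix (Fin n) (Fin n) ℂ)) :
    Set (Matrix (Fin n) (Fin n) ℂ) :=
  {A | A ∈ hermitianPart R ∧ ∀ B ∈ posCone R, 0 ≤ frobenius A B}

/-- The set `D(R)` of density matrices of `R`. -/
def densityMatrices {n : ℕ} (R : Submodule ℝ (Matrix (Fin n) (Fin n) ℂ)) :
    Set (Matrix (Fin n) (Fin n) ℂ) :=
  {ρ | ρ ∈ dualCone R ∧ ρ.trace = 1}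

/-- A map between (convex) sets is affine if it preserves convex combinations. -/
def IsAffine {E F : Type*} [AddCommGroup E] [Module ℝ E] [AddCommGroup F] [Module ℝ F]
    {K : Set E} {L : Set F} (f : K → L) : Prop :=
  ∀ (x y z : K) (s t : ℝ), 0 ≤ s → 0 ≤ t → s + t = 1 → (z : E) = s • (x : E) + t • (y : E) →
    (f z : F) = s • (f x : F) + t • (f y : F)

/-- An affine map `g : L → K` is a section of `f : K → L` if `f ∘ g = id`. -/
def IsSection {E F : Type*} [AddCommGroup E] [Module ℝ E] [AddCommGroup F] [Module ℝ F]
    {K : Set E} {L : Set F} (f : K → L) (g : L → K) : Prop :=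
  IsAffine g ∧ Function.LeftInverse f g

/-- A retraction: an affine map between compact convex sets that has an affine section. -/
structure IsRetraction {E F : Type*} [AddCommGroup E] [Module ℝ E] [TopologicalSpace E]
    [AddCommGroup F] [Module ℝ F] [TopologicalSpace F]
    {K : Set E} {L : Set F} (f : K → L) : Prop where
  isCompact_source : IsCompact K
  convex_source : Convex ℝ K
  isCompact_target : IsCompact L
  convex_target : Convex ℝ L
  isAffine : IsAffine f
  exists_section : ∃ g : L → K, IsSection f g

/-- The midpoint map `K × K → K`, `(x, y) ↦ (x + y) / 2`, of a convex set. -/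
noncomputable def midpointMap {E : Type*} [AddCommGroup E] [Module ℝ E]
    {K : Set E} (hK : Convex ℝ K) (p : K × K) : K :=
  ⟨(1 / 2 : ℝ) • ((p.1 : E) + (p.2 : E)), by
    rw [smul_add]
    exact hK p.1.2 p.2.2 (by norm_num) (by norm_num) (by norm_num)⟩

/-- A convex set is stable if its midpoint map is open (in the relative topologies). -/
def IsStable {E : Type*} [AddCommGroup E] [Module ℝ E] [TopologicalSpace E]
    (K : Set E) : Prop :=
  ∃ hK : Convex ℝ K, IsOpenMap (midpointMap hK)

end MatrixSystem

namespace MatrixSystem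

section
open scoped MatrixOrder Matrix.Norms.L2Operator

variable {n : ℕ}

/-! Pairing with elements of a `*`-closed subspace is unchanged by the projection, so dual
positivity and trace survive. For a `*`-algebra the dual positivity condition is genuine positivity,
because the negative part of a hermitian element stays in the algebra
(`posSemidef_of_frobenius_nonneg`); this gives the inclusion of density matrices.

Stability follows from continuous sections of the midpoint map through each pair `(X, Y)`. Put `z =
(X + Y) / 2` and let `Q` be the pseudo-inverse of `√z`, `P` the support projection. Then `X = √z (Q
X Q) √z`, and likewise for `Y`. Replacing the outer `√z` by `√w` moves the pair continuously; adding
`1 - P` to both middle factors makes their sum `2 • 1`, so the moved pair sums to `2w`. Traces may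
drift from 1, which `balance` repairs without changing the sum. -/

theorem _root_.Matrix.PosSemidef.trace_mul_nonneg {X Y : Matrix (Fin n) (Fin n) ℂ}
    (hX : X.PosSemidef) (hY : Y.PosSemidef) : 0 ≤ (X * Y).trace := by
  obtain ⟨S, rfl⟩ := CStarAlgebra.nonneg_iff_eq_star_mul_self.mp hX.nonneg
  rw [mul_assoc, Matrix.trace_mul_comm]
  exact (hY.mul_mul_conjTranspose_same S).trace_nonneg

theorem frobenius_nonneg {X Y : Matrix (Fin n) (Fin n) ℂ}
    (hX : X.PosSemidef) (hY : Y.PosSemidef) : 0 ≤ frobenius X Y := by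
  rw [frobenius, hX.isHermitian.eq]
  exact hX.trace_mul_nonneg hY

theorem frobenius_im_eq_zero {X Y : Matrix (Fin n) (Fin n) ℂ}
    (hX : X.IsHermitian) (hY : Y.IsHermitian) : (frobenius X Y).im = 0 := by
  have h : star (frobenius X Y) = frobenius X Y := by
    rw [frobenius_star_swap, frobenius, frobenius, hX.eq, hY.eq, Matrix.trace_mul_comm]
  exact Complex.conj_eq_iff_im.mp h

theorem re_frobenius_conjTranspose (X Y : Matrix (Fin n) (Fin n) ℂ) :
    (frobenius Xᴴ Y).re = (frobenius X Yᴴ).re := by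
  rw [frobenius, frobenius, Matrix.conjTranspose_conjTranspose, ← Matrix.conjTranspose_mul,
    Matrix.trace_conjTranspose, Matrix.trace_mul_comm]
  simp

/-! ### Projection of density matrices -/

theorem re_frobenius_orthProj (R : Submodule ℝ (Matrix (Fin n) (Fin n) ℂ))
    (X : Matrix (Fin n) (Fin n) ℂ) {B : Matrix (Fin n) (Fin n) ℂ} (hB : B ∈ R) :
    (frobenius (orthProj R X : Matrix (Fin n) (Fin n) ℂ) B).re = (frobenius X B).re := by
  have h := (orthProj_eq_iff R X _).mp rfl B hB
  simp only [frobenius, Matrix.conjTranspose_sub, Matrix.sub_mul, Matrix.trace_sub,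
    Complex.sub_re] at h ⊢
  linarith

theorem orthProj_isHermitian {R : Submodule ℝ (Matrix (Fin n) (Fin n) ℂ)}
    (hR : ∀ B ∈ R, Bᴴ ∈ R) {X : Matrix (Fin n) (Fin n) ℂ} (hX : X.IsHermitian) :
    (orthProj R X : Matrix (Fin n) (Fin n) ℂ).IsHermitian := by
  -- The adjoint of the projection satisfies the characterization of the projection of `Xᴴ = X`.
  have h : orthProj R X = ⟨_, hR _ (orthProj R X).2⟩ := by
    rw [orthProj_eq_iff]
    intro B hB
    have h1 := re_frobenius_orthProj R X (hR B hB)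
    rw [← re_frobenius_conjTranspose, ← re_frobenius_conjTranspose, hX.eq] at h1
    simp only [frobenius, Matrix.conjTranspose_sub, Matrix.sub_mul, Matrix.trace_sub,
      Complex.sub_re] at h1 ⊢
    linarith
  exact (congrArg Subtype.val h).symm

theorem orthProj_mem_densityMatrices {R : Submodule ℝ (Matrix (Fin n) (Fin n) ℂ)}
    (hR : ∀ B ∈ R, Bᴴ ∈ R) (h1 : 1 ∈ R) {X : Matrix (Fin n) (Fin n) ℂ}
    (hX : X ∈ densityMatrices (⊤ : Submodule ℝ (Matrix (Fin n) (Fin n) ℂ))) :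
    (orthProj R X : Matrix (Fin n) (Fin n) ℂ) ∈ densityMatrices R := by
  obtain ⟨⟨⟨-, hXh⟩, hXp⟩, hXt⟩ := hX
  have hH := orthProj_isHermitian hR hXh
  refine ⟨⟨⟨(orthProj R X).2, hH⟩, fun B hB => ?_⟩, ?_⟩
  · refine Complex.le_def.mpr ⟨?_, (frobenius_im_eq_zero hH hB.2.isHermitian).symm⟩
    rw [re_frobenius_orthProj R X hB.1]
    exact (Complex.le_def.mp (hXp B ⟨trivial, hB.2⟩)).1
  · have h2 := re_frobenius_orthProj R X h1
    have h3 := frobenius_im_eq_zero hH Matrix.isHermitian_one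
    simp only [frobenius, mul_one, hH.eq, hXh.eq, hXt] at h2 h3
    exact Complex.ext h2 h3

/-! ### Density matrices of a `*`-algebra: positivity, convexity, compactness -/

theorem isClosed_starSubalgebra (A : StarSubalgebra ℝ (Matrix (Fin n) (Fin n) ℂ)) :
    IsClosed (A : Set (Matrix (Fin n) (Fin n) ℂ)) :=
  A.toSubalgebra.toSubmodule.closed_of_finiteDimensional

theorem cfc_mem_starSubalgebra (A : StarSubalgebra ℝ (Matrix (Fin n) (Fin n) ℂ)) (f : ℝ → ℝ)
    {X : Matrix (Fin n) (Fin n) ℂ} (hX : X ∈ A) : cfc f X ∈ A :=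
  have := isClosed_starSubalgebra A
  cfc_mem (𝕜 := ℝ) (𝕜' := ℝ) f hX

theorem posSemidef_of_frobenius_nonneg (A : StarSubalgebra ℝ (Matrix (Fin n) (Fin n) ℂ))
    {X : Matrix (Fin n) (Fin n) ℂ} (hX : X ∈ A) (hXh : X.IsHermitian)
    (hXp : ∀ B ∈ A, B.PosSemidef → 0 ≤ frobenius X B) : X.PosSemidef := by
  have hsa : IsSelfAdjoint X := hXh
  -- `N` is the negative part of `X`. Testing against it gives `-tr (N * N) ≥ 0`, hence `N = 0`.
  set N := cfc (fun x : ℝ => max (-x) 0) X with hN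
  have hNp : N.PosSemidef := Matrix.nonneg_iff_posSemidef.mp (cfc_nonneg fun x _ => le_max_right _ _)
  have hXN : X * N = -(N * N) := by
    conv_lhs => rw [← cfc_id' ℝ X]
    rw [hN, ← cfc_mul .., ← cfc_mul .., ← cfc_neg ..]
    refine cfc_congr fun x _ => ?_
    rcases le_total x 0 with h | h <;> simp [h]
  have h := hXp N (cfc_mem_starSubalgebra A _ hX) hNp
  rw [frobenius, hXh.eq, hXN, Matrix.trace_neg, Left.nonneg_neg_iff] at h
  have h0 : (Nᴴ * N).trace = 0 := by
    rw [hNp.isHermitian.eq]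
    exact le_antisymm h (hNp.trace_mul_nonneg hNp)
  have hN0 := Matrix.trace_conjTranspose_mul_self_eq_zero_iff.mp h0
  rw [hN, ← cfc_zero ℝ X] at hN0
  have hs := (cfc_eq_cfc_iff_eqOn (a := X)).mp hN0
  rw [← Matrix.nonneg_iff_posSemidef, ← cfc_id' ℝ X]
  refine cfc_nonneg fun x hx => ?_
  have := hs hx
  simpa using this

theorem mem_densityMatrices_iff (A : StarSubalgebra ℝ (Matrix (Fin n) (Fin n) ℂ))
    {X : Matrix (Fin n) (Fin n) ℂ} :
    X ∈ densityMatrices A.toSubalgebra.toSubmodule ↔ X ∈ A ∧ X.PosSemidef ∧ X.trace = 1 :=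
  ⟨fun h => ⟨h.1.1.1, posSemidef_of_frobenius_nonneg A h.1.1.1 h.1.1.2
      fun B hB hBp => h.1.2 B ⟨hB, hBp⟩, h.2⟩,
    fun h => ⟨⟨⟨h.1, h.2.1.isHermitian⟩, fun _ hB => frobenius_nonneg h.2.1 hB.2⟩, h.2.2⟩⟩

theorem mem_densityMatrices_top_iff {X : Matrix (Fin n) (Fin n) ℂ} :
    X ∈ densityMatrices (⊤ : Submodule ℝ (Matrix (Fin n) (Fin n) ℂ)) ↔
      X.PosSemidef ∧ X.trace = 1 := by
  simpa using mem_densityMatrices_iff (⊤ : StarSubalgebra ℝ (Matrix (Fin n) (Fin n) ℂ)) (X := X)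

theorem convex_densityMatrices (R : Submodule ℝ (Matrix (Fin n) (Fin n) ℂ)) :
    Convex ℝ (densityMatrices R) := by
  intro X hX Y hY s t hs ht hst
  refine ⟨⟨⟨R.add_mem (R.smul_mem s hX.1.1.1) (R.smul_mem t hY.1.1.1), ?_⟩, fun B hB => ?_⟩, ?_⟩
  · rw [Matrix.IsHermitian, Matrix.conjTranspose_add, Matrix.conjTranspose_smul,
      Matrix.conjTranspose_smul, hX.1.1.2.eq, hY.1.1.2.eq]
    simp
  · have h : frobenius (s • X + t • Y) B = s • frobenius X B + t • frobenius Y B := by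
      simp [frobenius, Matrix.add_mul]
    rw [h]
    exact add_nonneg (smul_nonneg hs (hX.1.2 B hB)) (smul_nonneg ht (hY.1.2 B hB))
  · rw [Matrix.trace_add, Matrix.trace_smul, Matrix.trace_smul, hX.2, hY.2, ← add_smul, hst,
      one_smul]

theorem norm_le_one_of_posSemidef_of_trace_eq_one {X : Matrix (Fin n) (Fin n) ℂ}
    (hX : X.PosSemidef) (ht : X.trace = 1) : ‖X‖ ≤ 1 := by
  have hsa : IsSelfAdjoint X := hX.isHermitian
  rw [← cfc_id' ℝ X]
  refine norm_cfc_le zero_le_one fun x hx => ?_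
  rw [hX.isHermitian.spectrum_real_eq_range_eigenvalues] at hx
  obtain ⟨i, rfl⟩ := hx
  rw [Real.norm_of_nonneg (hX.eigenvalues_nonneg i)]
  have h : ∑ j, hX.isHermitian.eigenvalues j = 1 := by
    have := hX.isHermitian.trace_eq_sum_eigenvalues
    rw [ht] at this
    exact Complex.ofReal_injective (by push_cast; exact this.symm)
  rw [← h]
  exact Finset.single_le_sum (fun j _ => hX.eigenvalues_nonneg j) (Finset.mem_univ i)

theorem isCompact_densityMatrices (A : StarSubalgebra ℝ (Matrix (Fin n) (Fin n) ℂ)) :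
    IsCompact (densityMatrices A.toSubalgebra.toSubmodule) := by
  have : ProperSpace (Matrix (Fin n) (Fin n) ℂ) := FiniteDimensional.proper ℝ _
  have hset : densityMatrices A.toSubalgebra.toSubmodule =
      (A : Set (Matrix (Fin n) (Fin n) ℂ)) ∩ ({X | 0 ≤ X} ∩ {X | X.trace = 1}) := by
    ext X
    simp [mem_densityMatrices_iff, Matrix.nonneg_iff_posSemidef]
  have hcl : IsClosed (densityMatrices A.toSubalgebra.toSubmodule) := by
    rw [hset]
    exact (isClosed_starSubalgebra A).inter (CStarAlgebra.isClosed_nonneg.inter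
      (isClosed_eq (continuous_id.matrix_trace) continuous_const))
  refine (isCompact_closedBall (0 : Matrix (Fin n) (Fin n) ℂ) 1).of_isClosed_subset hcl ?_
  intro X hX
  rw [mem_densityMatrices_iff] at hX
  rw [mem_closedBall_zero_iff]
  exact norm_le_one_of_posSemidef_of_trace_eq_one hX.2.1 hX.2.2

/-! ### Stability: square roots, trace balancing, sections of the midpoint map -/

theorem sqrt_mem_starSubalgebra (A : StarSubalgebra ℝ (Matrix (Fin n) (Fin n) ℂ))
    {X : Matrix (Fin n) (Fin n) ℂ} (hX : X ∈ A) (hXp : X.PosSemidef) : CFC.sqrt X ∈ A := by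
  have h0 : 0 ≤ X := hXp.nonneg
  rw [CFC.sqrt_eq_real_sqrt X, cfcₙ_eq_cfc]
  exact cfc_mem_starSubalgebra A _ hX

/-- A pseudo-inverse `Q` of the square root of `Z`, with the support projection `P` of `Z`. -/
theorem exists_sqrt_pseudoInverse (A : StarSubalgebra ℝ (Matrix (Fin n) (Fin n) ℂ))
    {Z : Matrix (Fin n) (Fin n) ℂ} (hZ : Z ∈ A) (hZp : Z.PosSemidef) :
    ∃ Q ∈ A, ∃ P ∈ A, Q.IsHermitian ∧ P.IsHermitian ∧ (1 - P).PosSemidef ∧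
      CFC.sqrt Z * Q = P ∧ Q * CFC.sqrt Z = P ∧ Q * Z * Q = P ∧ Z * P = Z ∧
      CFC.sqrt Z * P = CFC.sqrt Z := by
  have h0 : 0 ≤ Z := hZp.nonneg
  have hsa : IsSelfAdjoint Z := hZp.isHermitian
  have hsp : ∀ x ∈ spectrum ℝ Z, 0 ≤ x := fun x hx => spectrum_nonneg_of_nonneg h0 hx
  -- A finite spectrum admits even functions that jump at `0`. Since `0⁻¹ = 0`, `√x * (√x)⁻¹` is the
  -- indicator of `x ≠ 0` there.
  have hc : ∀ f : ℝ → ℝ, ContinuousOn f (spectrum ℝ Z) :=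
    fun f => (Matrix.finite_real_spectrum (A := Z)).continuousOn f
  have hr : CFC.sqrt Z = cfc Real.sqrt Z := by rw [CFC.sqrt_eq_real_sqrt Z, cfcₙ_eq_cfc]
  have hid : Z = cfc (fun x : ℝ => x) Z := (cfc_id' ℝ Z).symm
  refine ⟨cfc (fun x => (√x)⁻¹) Z, cfc_mem_starSubalgebra A _ hZ,
    cfc (fun x => √x * (√x)⁻¹) Z, cfc_mem_starSubalgebra A _ hZ,
    cfc_predicate (R := ℝ) (p := IsSelfAdjoint) _ Z,
    cfc_predicate (R := ℝ) (p := IsSelfAdjoint) _ Z, ?_, ?_, ?_, ?_, ?_, ?_⟩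
  · refine Matrix.nonneg_iff_posSemidef.mp (sub_nonneg.mpr ?_)
    exact cfc_le_one _ _ fun x _ => mul_inv_le_one
  · rw [hr, ← cfc_mul _ _ Z (hc _) (hc _)]
  · rw [hr, ← cfc_mul _ _ Z (hc _) (hc _)]
    exact cfc_congr fun x _ => mul_comm _ _
  · conv_lhs => enter [1, 2]; rw [hid]
    rw [← cfc_mul _ _ Z (hc _) (hc _), ← cfc_mul _ _ Z (hc _) (hc _)]
    refine cfc_congr fun x hx => ?_
    have := Real.mul_self_sqrt (hsp x hx)
    by_cases h : √x = 0
    · simp [h]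
    · field_simp
      rw [sq, this]
  · conv_lhs => enter [1]; rw [hid]
    conv_rhs => rw [hid]
    rw [← cfc_mul _ _ Z (hc _) (hc _)]
    refine cfc_congr fun x hx => ?_
    have := Real.mul_self_sqrt (hsp x hx)
    by_cases h : √x = 0
    · have hx0 : x = 0 := by rw [← this, h, zero_mul]
      simp [hx0]
    · field_simp
  · rw [hr, ← cfc_mul _ _ Z (hc _) (hc _)]
    refine cfc_congr fun x hx => ?_
    by_cases h : √x = 0
    · simp [h]
    · field_simp

/-- Compressing `0 ≤ X ≤ Z` by `1 - P` kills `Z`, hence `X`; with `X = S* S` this forces `S (1 - P)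
= 0`. -/
theorem mul_eq_self_of_le {X Z P : Matrix (Fin n) (Fin n) ℂ} (hX : X.PosSemidef)
    (hXZ : (Z - X).PosSemidef) (hP : P.IsHermitian) (hZP : Z * P = Z) : X * P = X := by
  obtain ⟨S, rfl⟩ := CStarAlgebra.nonneg_iff_eq_star_mul_self.mp hX.nonneg
  have h1P : (1 - P)ᴴ = 1 - P := by simp [hP.eq]
  have h := hXZ.conjTranspose_mul_mul_same (1 - P)
  rw [mul_assoc, Matrix.sub_mul, mul_sub Z, mul_one, hZP, sub_self, zero_sub, mul_neg] at h
  have h2 : (S * (1 - P))ᴴ * (S * (1 - P)) = (1 - P)ᴴ * (star S * S * (1 - P)) := by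
    simp only [Matrix.conjTranspose_mul, mul_assoc, Matrix.star_eq_conjTranspose]
  rw [← h2] at h
  have h3 : (S * (1 - P))ᴴ * (S * (1 - P)) = 0 :=
    le_antisymm (neg_nonneg.mp h.nonneg) (Matrix.posSemidef_conjTranspose_mul_self _).nonneg
  have h4 := Matrix.conjTranspose_mul_self_eq_zero.mp h3
  rw [mul_sub, mul_one, sub_eq_zero] at h4
  rw [mul_assoc, ← h4]

/-- Rescaling of a pair of positive matrices with total trace `2` to trace one each. -/
noncomputable def balance (U V : Matrix (Fin n) (Fin n) ℂ) : Matrix (Fin n) (Fin n) ℂ :=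
  (max U.trace.re 1)⁻¹ • U + (1 - (max V.trace.re 1)⁻¹) • V

theorem balance_add_balance (U V : Matrix (Fin n) (Fin n) ℂ) :
    balance U V + balance V U = U + V := by
  simp only [balance, sub_smul, one_smul]
  abel

theorem balance_eq_left {U V : Matrix (Fin n) (Fin n) ℂ} (hU : U.trace = 1) (hV : V.trace = 1) :
    balance U V = U := by
  simp [balance, hU, hV]

/-- The heavier matrix is scaled down to trace one and the part removed is given to the lighter one,
which then also has trace one since the total is 2. -/
theorem balance_mem_densityMatrices (A : StarSubalgebra ℝ (Matrix (Fin n) (Fin n) ℂ))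
    {U V : Matrix (Fin n) (Fin n) ℂ} (hU : U ∈ A) (hV : V ∈ A) (hUp : U.PosSemidef)
    (hVp : V.PosSemidef) (h : (U + V).trace = 2) :
    balance U V ∈ densityMatrices A.toSubalgebra.toSubmodule := by
  rw [mem_densityMatrices_iff]
  refine ⟨add_mem (SMulMemClass.smul_mem _ hU) (SMulMemClass.smul_mem _ hV), ?_, ?_⟩
  · refine Matrix.nonneg_iff_posSemidef.mp (add_nonneg (smul_nonneg ?_ hUp.nonneg)
      (smul_nonneg (sub_nonneg.mpr ?_) hVp.nonneg))
    · positivity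
    · exact inv_le_one_of_one_le₀ (le_max_right _ _)
  · obtain ⟨u, hu0, hu⟩ := (RCLike.nonneg_iff_exists_ofReal (K := ℂ)).mp hUp.trace_nonneg
    obtain ⟨v, hv0, hv⟩ := (RCLike.nonneg_iff_exists_ofReal (K := ℂ)).mp hVp.trace_nonneg
    rw [Matrix.trace_add, ← hu, ← hv] at h
    have huv : u + v = 2 := Complex.ofReal_injective (by push_cast; exact h)
    rw [balance, Matrix.trace_add, Matrix.trace_smul, Matrix.trace_smul, ← hu, ← hv]
    have key : (max u 1)⁻¹ * u + (1 - (max v 1)⁻¹) * v = 1 := by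
      rcases le_total u 1 with h1 | h1
      · have h2 : 1 ≤ v := by linarith
        have h3 : v ≠ 0 := by linarith
        rw [max_eq_right h1, max_eq_left h2, sub_mul, inv_mul_cancel₀ h3]
        linarith
      · have h2 : v ≤ 1 := by linarith
        have h3 : u ≠ 0 := by linarith
        rw [max_eq_right h2, max_eq_left h1, inv_mul_cancel₀ h3]
        simp
    have := congrArg (Complex.ofReal) key
    simpa using this

theorem ContinuousAt.balance {T : Type*} [TopologicalSpace T] {t : T}
    {F G : T → Matrix (Fin n) (Fin n) ℂ} (hF : ContinuousAt F t) (hG : ContinuousAt G t) :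
    ContinuousAt (fun s => balance (F s) (G s)) t := by
  have hinv : ∀ H : T → Matrix (Fin n) (Fin n) ℂ, ContinuousAt H t →
      ContinuousAt (fun s => (max (H s).trace.re 1)⁻¹) t := by
    intro H hH
    have h1 : ContinuousAt (fun s => (H s).trace.re) t :=
      (Complex.continuous_re.comp continuous_id.matrix_trace).continuousAt.comp hH
    exact (h1.max continuousAt_const).inv₀ (by positivity)
  exact ((hinv F hF).smul hF).add ((continuousAt_const.sub (hinv G hG)).smul hG)

theorem isStable_densityMatrices (A : StarSubalgebra ℝ (Matrix (Fin n) (Fin n) ℂ)) :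
    IsStable (densityMatrices A.toSubalgebra.toSubmodule) := by
  refine ⟨convex_densityMatrices _, IsOpenMap.of_sections ?_⟩
  rintro ⟨⟨X, hX⟩, ⟨Y, hY⟩⟩
  obtain ⟨hXA, hXp, hXt⟩ := (mem_densityMatrices_iff A).mp hX
  obtain ⟨hYA, hYp, hYt⟩ := (mem_densityMatrices_iff A).mp hY
  set z := midpointMap (convex_densityMatrices A.toSubalgebra.toSubmodule) (⟨X, hX⟩, ⟨Y, hY⟩)
    with hz
  have hzv : (z : Matrix (Fin n) (Fin n) ℂ) = (1 / 2 : ℝ) • (X + Y) := rfl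
  have h2z : (2 : ℝ) • (z : Matrix (Fin n) (Fin n) ℂ) = X + Y := by
    rw [hzv, smul_smul]; norm_num
  obtain ⟨hzA, hzp, -⟩ := (mem_densityMatrices_iff A).mp z.2
  obtain ⟨Q, hQA, P, hPA, hQ, hP, h1P, hRQ, hQR, hQZQ, hZP, hRP⟩ :=
    exists_sqrt_pseudoInverse A hzA hzp
  have h2ZP : (X + Y) * P = X + Y := by rw [← h2z, smul_mul_assoc, hZP]
  have hXP : X * P = X := mul_eq_self_of_le hXp (by simpa using hYp) hP h2ZP
  have hYP : Y * P = Y := mul_eq_self_of_le hYp (by simpa using hXp) hP h2ZP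
  let R : densityMatrices A.toSubalgebra.toSubmodule → Matrix (Fin n) (Fin n) ℂ :=
    fun w => CFC.sqrt (w : Matrix (Fin n) (Fin n) ℂ)
  -- `1 - P` fills in the kernel of `z`, where a nearby `w` may have mass; at `w = z` it is
  -- annihilated by `√z`.
  let F : Matrix (Fin n) (Fin n) ℂ → densityMatrices A.toSubalgebra.toSubmodule →
      Matrix (Fin n) (Fin n) ℂ := fun W w => R w * (Q * W * Q + (1 - P)) * R w
  have hRh : ∀ w, (R w)ᴴ = R w := fun w =>
    (Matrix.nonneg_iff_posSemidef.mp (CFC.sqrt_nonneg _)).isHermitian.eq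
  have hRA : ∀ w, R w ∈ A := fun w =>
    sqrt_mem_starSubalgebra A ((mem_densityMatrices_iff A).mp w.2).1
      ((mem_densityMatrices_iff A).mp w.2).2.1
  have hRR : ∀ w, R w * R w = (w : Matrix (Fin n) (Fin n) ℂ) := fun w =>
    CFC.sqrt_mul_sqrt_self _ ((mem_densityMatrices_iff A).mp w.2).2.1.nonneg
  have hRc : Continuous R := CFC.continuousOn_sqrt.comp_continuous continuous_subtype_val
    fun w => ((mem_densityMatrices_iff A).mp w.2).2.1.nonneg
  have hFc : ∀ W, Continuous (F W) := fun W => (hRc.mul continuous_const).mul hRc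
  have hFA : ∀ W ∈ A, ∀ w, F W w ∈ A := fun W hW w =>
    mul_mem (mul_mem (hRA w) (add_mem (mul_mem (mul_mem hQA hW) hQA)
      (sub_mem (one_mem A) hPA))) (hRA w)
  have hFp : ∀ W, W.PosSemidef → ∀ w, (F W w).PosSemidef := fun W hW w => by
    have h1 := hW.conjTranspose_mul_mul_same Q
    rw [hQ.eq] at h1
    have h2 := (h1.add h1P).conjTranspose_mul_mul_same (R w)
    rwa [hRh] at h2
  have hFs : ∀ w, F X w + F Y w = (2 : ℝ) • (w : Matrix (Fin n) (Fin n) ℂ) := fun w => by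
    have h1 : Q * X * Q + Q * Y * Q = (2 : ℝ) • P := by
      rw [← add_mul, ← mul_add, ← h2z, mul_smul_comm, smul_mul_assoc, hQZQ]
    have h2 : Q * X * Q + (1 - P) + (Q * Y * Q + (1 - P)) = (2 : ℝ) • 1 := by
      rw [add_add_add_comm, h1, ← two_smul ℝ (1 - P), ← smul_add, add_sub_cancel]
    simp only [F]
    rw [← add_mul, ← mul_add, h2, mul_smul_comm, smul_mul_assoc, mul_one, hRR]
  have hFz : ∀ W, W.IsHermitian → W * P = W → F W z = W := fun W hW hWP => by
    have hPW : P * W = W := by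
      have := congrArg Matrix.conjTranspose hWP
      rwa [Matrix.conjTranspose_mul, hW.eq, hP.eq] at this
    have hRP' : R z * P = R z := hRP
    have hRQ' : R z * Q = P := hRQ
    have hQR' : Q * R z = P := hQR
    simp only [F]
    rw [mul_add, mul_sub, mul_one, hRP', sub_self, add_zero, mul_assoc Q, ← mul_assoc (R z), hRQ',
      mul_assoc, mul_assoc, hQR', hWP, hPW]
  have hFt : ∀ w, (F X w + F Y w).trace = 2 := fun w => by
    rw [hFs, Matrix.trace_smul, w.2.2]; simp
  refine ⟨fun w => (⟨balance (F X w) (F Y w), balance_mem_densityMatrices A (hFA X hXA w)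
      (hFA Y hYA w) (hFp X hXp w) (hFp Y hYp w) (hFt w)⟩,
    ⟨balance (F Y w) (F X w), balance_mem_densityMatrices A (hFA Y hYA w)
      (hFA X hXA w) (hFp Y hYp w) (hFp X hXp w) (by rw [add_comm]; exact hFt w)⟩), ?_, ?_, ?_⟩
  · exact ContinuousAt.prodMk
      (Topology.IsInducing.subtypeVal.continuousAt_iff.mpr <|
        ContinuousAt.balance (hFc X).continuousAt (hFc Y).continuousAt)
      (Topology.IsInducing.subtypeVal.continuousAt_iff.mpr <|
        ContinuousAt.balance (hFc Y).continuousAt (hFc X).continuousAt)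
  · have hX' := hFz X hXp.isHermitian hXP
    have hY' := hFz Y hYp.isHermitian hYP
    refine Prod.ext (Subtype.ext ?_) (Subtype.ext ?_)
    · change balance (F X z) (F Y z) = X
      rw [hX', hY', balance_eq_left hXt hYt]
    · change balance (F Y z) (F X z) = Y
      rw [hX', hY', balance_eq_left hYt hXt]
  · intro w
    refine Subtype.ext ?_
    change (1 / 2 : ℝ) • (balance (F X w) (F Y w) + balance (F Y w) (F X w)) = w
    rw [balance_add_balance, hFs, smul_smul]
    norm_num

end
end MatrixSystem

theorem mainTheorem2 (n : ℕ) (A : StarSubalgebra ℝ (Matrix (Fin n) (Fin n) ℂ)) :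
    ∃ (hπ : Set.MapsTo
          (fun X => (MatrixSystem.orthProj A.toSubalgebra.toSubmodule X :
            Matrix (Fin n) (Fin n) ℂ))
          (MatrixSystem.densityMatrices (⊤ : Submodule ℝ (Matrix (Fin n) (Fin n) ℂ)))
          (MatrixSystem.densityMatrices A.toSubalgebra.toSubmodule))
      (hι : MatrixSystem.densityMatrices A.toSubalgebra.toSubmodule ⊆
          MatrixSystem.densityMatrices (⊤ : Submodule ℝ (Matrix (Fin n) (Fin n) ℂ))),
      MatrixSystem.IsRetraction hπ.restrict ∧
      MatrixSystem.IsSection hπ.restrict (Set.inclusion hι) ∧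
      MatrixSystem.IsStable (MatrixSystem.densityMatrices A.toSubalgebra.toSubmodule) := by
  have hπ : Set.MapsTo
      (fun X => (MatrixSystem.orthProj A.toSubalgebra.toSubmodule X :
        Matrix (Fin n) (Fin n) ℂ))
      (MatrixSystem.densityMatrices (⊤ : Submodule ℝ (Matrix (Fin n) (Fin n) ℂ)))
      (MatrixSystem.densityMatrices A.toSubalgebra.toSubmodule) := fun X hX =>
    MatrixSystem.orthProj_mem_densityMatrices (fun B hB => star_mem (S := _) (s := A) hB)
      (one_mem A) hX
  have hι : MatrixSystem.densityMatrices A.toSubalgebra.toSubmodule ⊆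
      MatrixSystem.densityMatrices (⊤ : Submodule ℝ (Matrix (Fin n) (Fin n) ℂ)) := fun X hX =>
    MatrixSystem.mem_densityMatrices_top_iff.mpr ((MatrixSystem.mem_densityMatrices_iff A).mp hX).2
  have hsec : MatrixSystem.IsSection hπ.restrict (Set.inclusion hι) := by
    -- The projection fixes its range.
    refine ⟨fun x y z s t _ _ _ h => h, fun x => Subtype.ext ?_⟩
    have h := congrArg Subtype.val (Submodule.projectionOnto_apply_left
      (MatrixSystem.isCompl_orthogonal A.toSubalgebra.toSubmodule) ⟨x, x.2.1.1.1⟩)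
    exact h
  refine ⟨hπ, hι, ⟨?_, MatrixSystem.convex_densityMatrices _,
    MatrixSystem.isCompact_densityMatrices A, MatrixSystem.convex_densityMatrices _, ?_,
    _, hsec⟩, hsec, MatrixSystem.isStable_densityMatrices A⟩
  · have h := MatrixSystem.isCompact_densityMatrices
      (⊤ : StarSubalgebra ℝ (Matrix (Fin n) (Fin n) ℂ))
    rwa [StarSubalgebra.top_toSubalgebra, Algebra.top_toSubmodule] at h
  · intro x y z s t _ _ _ h
    change (MatrixSystem.orthProj A.toSubalgebra.toSubmodule (z : Matrix (Fin n) (Fin n) ℂ) :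
      Matrix (Fin n) (Fin n) ℂ) = _
    rw [h, map_add, map_smul, map_smul]
    rfl
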